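/- **Theorem C.** There exists a field $K$ with $\operatorname{char} K\neq 2$ such that 1. there are infinitely many pairwise non-isomorphic quaternion division algebras with center $K$ (that is, the set $\mathrm{Quat}^*(K)$ of $K$-isomorphism classes of quaternion division algebras with center $K$ is infinite), and 2. any two quaternion division algebras $D, D'$ with center $K$ are weakly isomorphic: every maximal subfield of $D$ is $K$-isomorphic to a maximal subfield of $D'$, and vice versa. Here a quaternion algebra with center $K$ is a $K$-algebra isomorphic to $\left(\frac{a,b}{K}\right)$ for some $a,b\in K^\times$, i.e. to the $4$-dimensional $K$-algebra with basis $1,i,j,ij$ and $i^2=a$, $j^2=b$, $ij=-ji$; and a maximal subfield of a division algebra $D$ with center $K$ is a maximal element of the poset of fields $E$ with $K\subseteq E\subseteq D$. -/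

import Mathlib

open scoped Quaternion

/-- `D` is a quaternion algebra over the field `K` (of characteristic not `2`): it is isomorphic, as
a `K`-algebra, to a Hilbert symbol `(a, b / K)` with `a, b ∈ Kˣ`, i.e. to the algebra with basis
`1, i, j, ij` and relations `i² = a`, `j² = b`, `ij = -ji`. -/
def IsQuaternionAlgebra (K D : Type*) [Field K] [Ring D] [Algebra K D] : Prop :=
  ∃ a b : K, a ≠ 0 ∧ b ≠ 0 ∧ Nonempty (D ≃ₐ[K] ℍ[K, a, b])

/-- A quaternion division algebra over `K`. -/
structure QuatDivAlg (K : Type) [Field K] where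
  carrier : Type
  [divisionRing : DivisionRing carrier]
  [algebra : Algebra K carrier]
  isQuaternionAlgebra : IsQuaternionAlgebra K carrier

attribute [instance] QuatDivAlg.divisionRing QuatDivAlg.algebra

instance (K : Type) [Field K] : CoeSort (QuatDivAlg K) Type := ⟨QuatDivAlg.carrier⟩

/-- Isomorphism of quaternion division algebras over `K`. -/
instance QuatDivAlg.isoSetoid (K : Type) [Field K] : Setoid (QuatDivAlg K) where
  r D D' := Nonempty (D ≃ₐ[K] D')
  iseqv :=
    { refl := fun _ => ⟨AlgEquiv.refl⟩
      symm := fun ⟨e⟩ => ⟨e.symm⟩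
      trans := fun ⟨e⟩ ⟨f⟩ => ⟨e.trans f⟩ }

/-- `Quat*(K)`: the set of isomorphism classes of quaternion division algebras over `K`. -/
def QuatStar (K : Type) [Field K] : Type 1 := Quotient (QuatDivAlg.isoSetoid K)

/-- `E` is a maximal subfield of the division `K`-algebra `D`: a maximal element of the poset of
fields `E` with `K ⊆ E ⊆ D`. -/
def IsMaximalSubfield (K : Type*) {D : Type*} [Field K] [DivisionRing D] [Algebra K D]
    (E : Subalgebra K D) : Prop :=
  Maximal (fun F : Subalgebra K D => IsField F) E

/-- `D` and `D'` are weakly isomorphic over `K`: the sets of `K`-isomorphism classes of their maximal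
subfields coincide. -/
def WeaklyIsomorphic (K D D' : Type*) [Field K] [DivisionRing D] [Algebra K D]
    [DivisionRing D'] [Algebra K D'] : Prop :=
  (∀ E : Subalgebra K D, IsMaximalSubfield K E →
    ∃ E' : Subalgebra K D', IsMaximalSubfield K E' ∧ Nonempty (E ≃ₐ[K] E')) ∧
  (∀ E' : Subalgebra K D', IsMaximalSubfield K E' →
    ∃ E : Subalgebra K D, IsMaximalSubfield K E ∧ Nonempty (E ≃ₐ[K] E'))

open Polynomial

/-! For nonsquare `d`, the field `K(√d)` embeds in `(a, b / K)` exactly when the pure form `⟨a, b,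
-ab⟩` represents `d`, and every maximal subfield has this shape. So all quaternion division algebras
are weakly isomorphic once every pure form represents every nonsquare. Starting from `ℚ`, each
missing representation is forced by passing to the function field of the quadric `a x² + b y² - a b
z² = d`, realised as `K(v, y)(s)` inside `ℂ`; a countable tower of such steps gives `K`.

Infinitely many algebras must survive. The quadric has discriminant `d`, and for nonsquare `d` its
function field splits no nonsplit quaternion algebra (`NotNorm.quadric`). Otherwise the
Cassels–Pfister theorem, applied in `y` and then in `v`, would express `⟨b, -ab⟩` by a binary form
of determinant `-ad` up to squares, and comparing determinants makes `d` a square.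

Hence every nonsplit `(-1, c / ℚ)` stays nonsplit over `K`. For distinct primes `p, q ≡ 3 mod 4`, an
isomorphism `(-1, p) ≃ (-1, q)` would split `(-1, pq)`, which is nonsplit over `ℚ` because `pq`
times a nonzero square is never a sum of two squares. -/

/-- The diagonal quadratic form with coefficients `c` has no nontrivial zero. -/
def AnisotropicDiagonal {K ι : Type*} [Field K] [Fintype ι] (c : ι → K) : Prop :=
  ∀ v : ι → K, ∑ i, c i * v i ^ 2 = 0 → v = 0

/-! ### The Cassels–Pfister theorem -/

section CasselsPfister

variable {K ι : Type*} [Field K] [Fintype ι] {c : ι → K}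

theorem sum_mul_linear_combination_sq {R : Type*} [CommRing R] (c v w : ι → R) (a b : R) :
    ∑ i, c i * (a * v i + b * w i) ^ 2 =
      a ^ 2 * ∑ i, c i * v i ^ 2 + 2 * a * b * ∑ i, c i * (v i * w i) +
        b ^ 2 * ∑ i, c i * w i ^ 2 := by
  simp only [Finset.mul_sum, ← Finset.sum_add_distrib]
  exact Finset.sum_congr rfl fun i _ => by ring

/-- For an anisotropic form, leading coefficients cannot cancel. -/
theorem AnisotropicDiagonal.natDegree_le (hc : AnisotropicDiagonal c) {v : ι → K[X]} {n : ℕ}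
    (h : (∑ i, C (c i) * v i ^ 2).natDegree ≤ 2 * n) (i : ι) : (v i).natDegree ≤ n := by
  by_contra! hlt
  set m := Finset.univ.sup fun i => (v i).natDegree with hm
  have hle : ∀ j, (v j).natDegree ≤ m := fun j =>
    Finset.le_sup (f := fun i => (v i).natDegree) (Finset.mem_univ j)
  have hnm : n < m := hlt.trans_le (hle i)
  obtain ⟨j, -, hj⟩ := Finset.exists_mem_eq_sup Finset.univ ⟨i, Finset.mem_univ i⟩
    fun i => (v i).natDegree
  have hcoeff : (∑ i, C (c i) * v i ^ 2).coeff (2 * m) = 0 :=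
    coeff_eq_zero_of_natDegree_lt (by omega)
  rw [finsetSum_coeff] at hcoeff
  have := congr_fun (hc (fun i => (v i).coeff m) (by
    rw [← hcoeff]
    refine Finset.sum_congr rfl fun k _ => ?_
    rw [coeff_C_mul, coeff_pow_of_natDegree_le (hle k)])) j
  have hjm : (v j).natDegree = m := hj.symm
  have h0 : (v j).leadingCoeff = 0 := by rw [leadingCoeff, hjm]; exact this
  rw [leadingCoeff_eq_zero] at h0
  rw [h0, natDegree_zero] at hjm
  omega

theorem AnisotropicDiagonal.polynomial_eq_zero (hc : AnisotropicDiagonal c) {v : ι → K[X]}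
    (h : ∑ i, C (c i) * v i ^ 2 = 0) : v = 0 := by
  have hdeg : ∀ i, (v i).natDegree ≤ 0 := hc.natDegree_le (by simp [h])
  have hv : ∀ i, v i = C ((v i).coeff 0) := fun i => eq_C_of_natDegree_le_zero (hdeg i)
  have h0 : ∑ i, c i * (v i).coeff 0 ^ 2 = 0 := by
    apply C_injective
    rw [map_sum, map_zero, ← h]
    refine Finset.sum_congr rfl fun i _ => ?_
    rw [map_mul, map_pow, ← hv]
  ext1 i
  rw [hv i, show (v i).coeff 0 = 0 from congr_fun (hc _ h0) i, map_zero, Pi.zero_apply]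

/-- **Cassels–Pfister theorem** for anisotropic diagonal forms: a polynomial represented over the
field of rational functions is represented over the polynomial ring. -/
theorem AnisotropicDiagonal.casselsPfister (hc : AnisotropicDiagonal c) {f : K[X]} (n : ℕ) :
    ∀ {h : K[X]} {v : ι → K[X]}, h.natDegree ≤ n → h ≠ 0 →
      ∑ i, C (c i) * v i ^ 2 = f * h ^ 2 → ∃ w : ι → K[X], ∑ i, C (c i) * w i ^ 2 = f := by
  induction n with
  | zero =>
    intro h v hn h0 hv
    obtain ⟨k, rfl⟩ : ∃ k, h = C k := ⟨_, eq_C_of_natDegree_le_zero hn⟩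
    have hk : k ≠ 0 := by rintro rfl; simp at h0
    refine ⟨fun i => C k⁻¹ * v i, ?_⟩
    have : ∑ i, C (c i) * (C k⁻¹ * v i) ^ 2 = C k⁻¹ ^ 2 * ∑ i, C (c i) * v i ^ 2 := by
      rw [Finset.mul_sum]
      exact Finset.sum_congr rfl fun i _ => by ring
    rw [this, hv, mul_left_comm, ← mul_pow, ← C_mul, inv_mul_cancel₀ hk]
    simp
  | succ n ih =>
    intro h v hn h0 hv
    by_cases hn' : h.natDegree ≤ n
    · exact ih hn' h0 hv
    -- Cassels' descent: `w` is the polynomial point approximating `v / h`. The line through both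
    -- meets the quadric of value `f` in a second point, whose denominator turns out smaller.
    set w : ι → K[X] := fun i => v i / h
    set r : ι → K[X] := fun i => v i % h
    have hvr : ∀ i, r i = 1 * v i + (-h) * w i := fun i => by
      have := EuclideanDomain.div_add_mod (v i) h
      simp only [r, w]
      linear_combination this
    have hrdeg : ∀ i, (r i).natDegree ≤ n := fun i => by
      have := natDegree_mod_lt (v i) (q := h) (by omega)
      simp only [r]; omega
    set S := ∑ i, C (c i) * (v i * w i) with hS
    set W := ∑ i, C (c i) * w i ^ 2 with hW
    have hqr : ∑ i, C (c i) * r i ^ 2 = f * h ^ 2 - 2 * h * S + h ^ 2 * W := by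
      simp only [hvr]
      rw [sum_mul_linear_combination_sq, hv, ← hS, ← hW]
      ring
    by_cases hr : r = 0
    · refine ⟨w, ?_⟩
      have hvw : ∀ i, v i = h * w i := fun i => by
        have h1 := hvr i
        rw [hr, Pi.zero_apply] at h1
        linear_combination -h1
      have : h ^ 2 * W = h ^ 2 * f := by
        rw [mul_comm _ f, ← hv, hW, Finset.mul_sum]
        exact Finset.sum_congr rfl fun i _ => by rw [hvw i]; ring
      exact mul_left_cancel₀ (pow_ne_zero 2 h0) this
    · have hq0 : ∑ i, C (c i) * r i ^ 2 ≠ 0 := fun h' => hr (hc.polynomial_eq_zero h')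
      set a := W - f with ha
      set b := 2 * (h * f - S) with hb
      -- The new denominator is the value at `r` divided by `h`; since `deg h = n + 1` and `deg r ≤
      -- n`, its degree drops.
      have hh' : h * (a * h + b) = ∑ i, C (c i) * r i ^ 2 := by rw [hqr, ha, hb]; ring
      have hne : a * h + b ≠ 0 := by
        intro h'
        rw [h', mul_zero] at hh'
        exact hq0 hh'.symm
      refine ih (h := a * h + b) (v := fun i => a * v i + b * w i) ?_ hne ?_
      · have h1 := natDegree_mul h0 hne
        have h2 : (∑ i, C (c i) * r i ^ 2).natDegree ≤ 2 * n := by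
          refine natDegree_sum_le_of_forall_le _ _ fun i _ => ?_
          refine (natDegree_C_mul_le _ _).trans (natDegree_pow_le.trans ?_)
          have := hrdeg i
          omega
        rw [hh'] at h1
        omega
      · rw [sum_mul_linear_combination_sq, hv, ← hS, ← hW, ha, hb]
        ring

end CasselsPfister

/-! ### Anisotropic forms over rational function fields -/

section Transcendental

open IntermediateField

variable {K L ι : Type*} [Field K] [Field L] [Algebra K L] [Fintype ι] {c : ι → K} {t : L}

theorem exists_common_denominator (ht : Transcendental K t) (w : ι → L) (hw : ∀ i, w i ∈ K⟮t⟯) :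
    ∃ (h : K[X]) (v : ι → K[X]), h ≠ 0 ∧ ∀ i, aeval t h * w i = aeval t (v i) := by
  classical
  have : ∀ i, ∃ r s : K[X], s ≠ 0 ∧ w i * aeval t s = aeval t r := fun i => by
    obtain ⟨r, s, hrs⟩ := (mem_adjoin_simple_iff K _).1 (hw i)
    by_cases hs : s = 0
    · exact ⟨0, 1, one_ne_zero, by simp [hrs, hs]⟩
    · refine ⟨r, s, hs, ?_⟩
      have : aeval t s ≠ 0 := fun h => hs ((transcendental_iff.1 ht) s h)
      rw [hrs, div_mul_cancel₀ _ this]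
  choose r s hs hrs using this
  refine ⟨∏ i, s i, fun i => r i * ∏ j ∈ Finset.univ.erase i, s j,
    Finset.prod_ne_zero_iff.2 fun i _ => hs i, fun i => ?_⟩
  rw [← Finset.mul_prod_erase _ _ (Finset.mem_univ i), map_mul, map_mul, ← hrs]
  ring

theorem exists_polynomial_sum_eq (ht : Transcendental K t) {f : K[X]} {w : ι → L}
    (hw : ∀ i, w i ∈ K⟮t⟯) (h : ∑ i, algebraMap K L (c i) * w i ^ 2 = aeval t f) :
    ∃ (g : K[X]) (v : ι → K[X]), g ≠ 0 ∧ (∀ i, aeval t g * w i = aeval t (v i)) ∧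
      ∑ i, C (c i) * v i ^ 2 = f * g ^ 2 := by
  obtain ⟨g, v, hg, hv⟩ := exists_common_denominator ht w hw
  refine ⟨g, v, hg, hv, transcendental_iff_injective.1 ht ?_⟩
  simp only [map_sum, map_mul, map_pow, aeval_C, ← hv, ← h]
  rw [Finset.sum_mul]
  exact Finset.sum_congr rfl fun i _ => by ring

/-- Anisotropy is preserved by purely transcendental extensions. -/
theorem AnisotropicDiagonal.eq_zero_of_mem_adjoin (hc : AnisotropicDiagonal c)
    (ht : Transcendental K t) {w : ι → L} (hw : ∀ i, w i ∈ K⟮t⟯)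
    (h : ∑ i, algebraMap K L (c i) * w i ^ 2 = 0) : w = 0 := by
  obtain ⟨g, v, hg, hv, hsum⟩ := exists_polynomial_sum_eq (f := 0) ht hw (by simpa using h)
  rw [zero_mul] at hsum
  have hv0 := hc.polynomial_eq_zero hsum
  have hgt : aeval t g ≠ 0 := fun h => hg ((transcendental_iff.1 ht) g h)
  ext1 i
  simpa [hv0, hgt] using hv i

/-- If an anisotropic form represents `b + a t²` over `K(t)`, then it already represents `b` and `a`
over `K` at orthogonal vectors. -/
theorem AnisotropicDiagonal.exists_orthogonal (hc : AnisotropicDiagonal c) (h2 : (2 : K) ≠ 0)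
    (ht : Transcendental K t) {a b : K} {w : ι → L} (hw : ∀ i, w i ∈ K⟮t⟯)
    (h : ∑ i, algebraMap K L (c i) * w i ^ 2 = algebraMap K L b + algebraMap K L a * t ^ 2) :
    ∃ P Q : ι → K, ∑ i, c i * P i ^ 2 = b ∧ ∑ i, c i * (P i * Q i) = 0 ∧
      ∑ i, c i * Q i ^ 2 = a := by
  obtain ⟨g, v, hg, hv, hsum⟩ := exists_polynomial_sum_eq (f := C b + C a * X ^ 2) ht hw
    (by simpa using h)
  obtain ⟨u, hu⟩ := hc.casselsPfister _ le_rfl hg hsum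
  -- Anisotropy forces a polynomial representation of a quadratic to be linear, `P + Q X`; comparing
  -- coefficients gives the three equations.
  have hdeg : ∀ i, (u i).natDegree ≤ 1 := hc.natDegree_le (by rw [hu]; compute_degree)
  have hui : ∀ i, u i = 1 * C ((u i).coeff 0) + X * C ((u i).coeff 1) := fun i => by
    conv_lhs => rw [eq_X_add_C_of_natDegree_le_one (hdeg i)]
    ring
  set P := fun i => (u i).coeff 0
  set Q := fun i => (u i).coeff 1
  have key : C (∑ i, c i * P i ^ 2) + C (2 * ∑ i, c i * (P i * Q i)) * X +
      C (∑ i, c i * Q i ^ 2) * X ^ 2 = C b + C a * X ^ 2 := by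
    rw [← hu]
    have : ∑ i, C (c i) * u i ^ 2 = ∑ i, C (c i) * (1 * C (P i) + X * C (Q i)) ^ 2 :=
      Finset.sum_congr rfl fun i _ => by rw [hui i]
    rw [this, sum_mul_linear_combination_sq (fun i => C (c i)) (fun i => C (P i)) fun i => C (Q i)]
    simp only [map_sum, map_mul, map_pow]
    rw [show (C 2 : K[X]) = 2 from rfl]
    ring
  have h0 := congr_arg (fun p => coeff p 0) key
  have h1 := congr_arg (fun p => coeff p 1) key
  have h3 := congr_arg (fun p => coeff p 2) key
  simp [coeff_X, coeff_C, coeff_X_pow, -map_sum, -map_mul] at h0 h1 h3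
  exact ⟨P, Q, h0, by simpa [h2] using h1, h3⟩

end Transcendental

/-! ### Nonsplit quaternion algebras and their pure forms -/

/-- `C` is not of the form `u² - A v²`; for `A ≠ 0` and characteristic not `2` this says that the
quaternion algebra `(A, C / K)` is not split. -/
def NotNorm {K : Type*} [Field K] (A C : K) : Prop :=
  ∀ u v : K, u ^ 2 - A * v ^ 2 ≠ C

section NotNorm

variable {K : Type*} [Field K] {A C : K}

/-- If `A` were a square, `u² - A v²` would be hyperbolic and hence universal. -/
theorem NotNorm.not_sq (h : NotNorm A C) (h2 : (2 : K) ≠ 0) (hA : A ≠ 0) (r : K) : r ^ 2 ≠ A := by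
  rintro rfl
  have hr : r ≠ 0 := by rintro rfl; simp at hA
  refine h ((C + 1) / 2) ((C - 1) / (2 * r)) ?_
  field_simp
  ring

theorem eq_zero_of_sq_sub_mul_sq_eq_zero (hA : ∀ r : K, r ^ 2 ≠ A) {p q : K}
    (h : p ^ 2 - A * q ^ 2 = 0) : p = 0 ∧ q = 0 := by
  have hq : q = 0 := by
    by_contra hq
    refine hA (p / q) ?_
    field_simp
    linear_combination h
  subst hq
  exact ⟨by simpa using h, rfl⟩

/-- Anisotropy of the quaternion norm form: a quotient of two norms from `K(√A)` is again a norm,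
here `(s + w√A) / (p + q√A)`. -/
theorem NotNorm.eq_zero_of_mul_eq (h : NotNorm A C) (h2 : (2 : K) ≠ 0) (hA : A ≠ 0) {p q s w : K}
    (heq : C * (p ^ 2 - A * q ^ 2) = s ^ 2 - A * w ^ 2) : (p = 0 ∧ q = 0) ∧ s = 0 ∧ w = 0 := by
  by_cases hN : p ^ 2 - A * q ^ 2 = 0
  · have hpq := eq_zero_of_sq_sub_mul_sq_eq_zero (h.not_sq h2 hA) hN
    rw [hN, mul_zero] at heq
    exact ⟨hpq, eq_zero_of_sq_sub_mul_sq_eq_zero (h.not_sq h2 hA) heq.symm⟩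
  · refine (h ((s * p - A * w * q) / (p ^ 2 - A * q ^ 2))
      ((w * p - s * q) / (p ^ 2 - A * q ^ 2)) ?_).elim
    field_simp
    linear_combination -(p ^ 2 - A * q ^ 2) * heq

theorem NotNorm.anisotropic_ternary (h : NotNorm A C) (h2 : (2 : K) ≠ 0) (hA : A ≠ 0) :
    AnisotropicDiagonal ![1, -A, -C] := by
  intro v hv
  simp only [Fin.sum_univ_three, Matrix.cons_val] at hv
  obtain ⟨⟨h2, -⟩, h0, h1⟩ := h.eq_zero_of_mul_eq h2 hA (p := v 2) (q := 0) (s := v 0) (w := v 1)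
    (by linear_combination -hv)
  ext i
  fin_cases i <;> assumption

theorem NotNorm.anisotropic_pure (h : NotNorm A C) (h2 : (2 : K) ≠ 0) (hA : A ≠ 0) :
    AnisotropicDiagonal ![A, C, -(A * C)] := by
  intro v hv
  simp only [Fin.sum_univ_three, Matrix.cons_val] at hv
  obtain ⟨⟨h1, h2⟩, -, h0⟩ := h.eq_zero_of_mul_eq h2 hA (p := v 1) (q := v 2) (s := 0) (w := v 0)
    (by linear_combination hv)
  ext i
  fin_cases i <;> assumption

theorem NotNorm.pure_ne_sq (h : NotNorm A C) (h2 : (2 : K) ≠ 0) (hA : A ≠ 0) {α w p q : K}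
    (hα : α ≠ 0) (heq : A * w ^ 2 + C * p ^ 2 - A * C * q ^ 2 = α) (r : K) : r ^ 2 ≠ α := by
  rintro rfl
  obtain ⟨-, rfl, -⟩ := h.eq_zero_of_mul_eq h2 hA (p := p) (q := q) (s := r) (w := w)
    (by linear_combination heq)
  simp at hα

theorem anisotropic_binary {α γ : K} (hα : ∀ r : K, r ^ 2 ≠ α) (hγ : γ ≠ 0) :
    AnisotropicDiagonal ![γ, -(γ * α)] := by
  intro v hv
  simp only [Fin.sum_univ_two, Matrix.cons_val] at hv
  have : γ * (v 0 ^ 2 - α * v 1 ^ 2) = 0 := by linear_combination hv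
  obtain ⟨h0, h1⟩ := eq_zero_of_sq_sub_mul_sq_eq_zero hα ((mul_eq_zero.1 this).resolve_left hγ)
  ext i
  fin_cases i <;> assumption

/-- If the pure part of `(A, C)` represents `α` then it is isometric to `⟨α, γ, -αγ⟩` for some `γ`;
the isometry is given by the three linear forms `x`, `y`, `z`. -/
theorem NotNorm.exists_isometry (h : NotNorm A C) (h2 : (2 : K) ≠ 0) (hA : A ≠ 0) {α w p q : K}
    (hα : α ≠ 0) (heq : A * w ^ 2 + C * p ^ 2 - A * C * q ^ 2 = α) :
    ∃ (γ : K) (x y z : Fin 3 → K), γ ≠ 0 ∧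
      (α * x 0 * x 0 + γ * y 0 * y 0 - α * γ * z 0 * z 0 = A) ∧
      (α * x 1 * x 1 + γ * y 1 * y 1 - α * γ * z 1 * z 1 = C) ∧
      (α * x 2 * x 2 + γ * y 2 * y 2 - α * γ * z 2 * z 2 = -(A * C)) ∧
      (α * x 0 * x 1 + γ * y 0 * y 1 - α * γ * z 0 * z 1 = 0) ∧
      (α * x 0 * x 2 + γ * y 0 * y 2 - α * γ * z 0 * z 2 = 0) ∧
      (α * x 1 * x 2 + γ * y 1 * y 2 - α * γ * z 1 * z 2 = 0) := by
  have hC : C ≠ 0 := fun hC => h 0 0 (by simp [hC])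
  by_cases hδ : A * w ^ 2 + C * p ^ 2 = 0
  · have hq : q ≠ 0 := by
      rintro rfl
      exact hα (by rw [← heq, hδ]; ring)
    obtain ⟨⟨hp, -⟩, -, hw⟩ := h.eq_zero_of_mul_eq h2 hA (p := p) (q := 0) (s := 0) (w := w)
      (by linear_combination hδ)
    -- Here `w = p = 0`, so `α = -A C q²` and permuting and rescaling the basis suffices.
    refine ⟨A, ![0, 0, 1 / q], ![1, 0, 0], ![0, 1 / (A * q), 0], hA, ?_⟩
    simp only [Matrix.cons_val, ← heq, hp, hw]
    refine ⟨?_, ?_, ?_, ?_, ?_, ?_⟩ <;> field_simp <;> ring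
  · set δ := A * w ^ 2 + C * p ^ 2 with hδ'
    -- Coordinates in the orthogonal basis `(w, p, q)`, `(-Cp, Aw, 0)`, `(-ACqw, -ACqp, -δ)`, whose
    -- values are `α`, `γ = ACδ` and `-αγ`.
    refine ⟨A * C * δ, ![A * w / α, C * p / α, -(A * C) * q / α], ![-p / δ, w / δ, 0],
      ![A * q * w / (α * δ), C * p * q / (α * δ), -1 / α], by positivity, ?_⟩
    simp only [Matrix.cons_val]
    refine ⟨?_, ?_, ?_, ?_, ?_, ?_⟩ <;> field_simp <;> simp only [← heq, hδ'] <;> ring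

/-- A vector orthogonal to one of norm `α` in `⟨α, γ, -αγ⟩` can be moved into `⟨γ, -αγ⟩`. -/
theorem exists_eq_mul_norm_of_orthogonal {α β γ w₀ p₀ q₀ w₁ p₁ q₁ : K}
    (hα : ∀ r : K, r ^ 2 ≠ α) (hγ : γ ≠ 0)
    (h0 : α * w₀ ^ 2 + γ * (p₀ ^ 2 - α * q₀ ^ 2) = β)
    (h1 : α * w₁ ^ 2 + γ * (p₁ ^ 2 - α * q₁ ^ 2) = α)
    (h01 : α * w₀ * w₁ + γ * (p₀ * p₁ - α * q₀ * q₁) = 0) :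
    ∃ r s : K, γ * (r ^ 2 - α * s ^ 2) = β := by
  have hα0 : α ≠ 0 := fun h => hα 0 (by simp [h])
  by_cases hw : 1 - w₁ = 0
  · have hw' : w₁ = 1 := by linear_combination -hw
    subst hw'
    have hN : γ * (p₁ ^ 2 - α * q₁ ^ 2) = 0 := by linear_combination h1
    obtain ⟨rfl, rfl⟩ :=
      eq_zero_of_sq_sub_mul_sq_eq_zero hα ((mul_eq_zero.1 hN).resolve_left hγ)
    have : w₀ = 0 := by simpa [hα0] using h01
    subst this
    exact ⟨p₀, q₀, by linear_combination h0⟩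
  -- Reflect in the difference of the vector of norm `α` and the first basis vector; this kills the
  -- first coordinate of the other vector.
  · refine ⟨p₀ + w₀ * p₁ / (1 - w₁), q₀ + w₀ * q₁ / (1 - w₁), ?_⟩
    field_simp
    linear_combination (1 - w₁) ^ 2 * h0 + 2 * w₀ * (1 - w₁) * h01 + w₀ ^ 2 * h1

end NotNorm

/-! ### Nonsplit algebras over function fields of quadrics -/

section Extension

open IntermediateField

variable {K L : Type*} [Field K] [Field L] [Algebra K L] {A C : K}

theorem two_ne_zero_of_algebra (h2 : (2 : K) ≠ 0) : (2 : L) ≠ 0 := by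
  rw [← map_ofNat (algebraMap K L) 2]
  exact (_root_.map_ne_zero _).2 h2

theorem NotNorm.adjoin_transcendental (h : NotNorm A C) (h2 : (2 : K) ≠ 0) (hA : A ≠ 0) {t : L}
    (ht : Transcendental K t) : NotNorm (algebraMap K K⟮t⟯ A) (algebraMap K K⟮t⟯ C) := by
  intro u v huv
  have huv' : (u : L) ^ 2 - algebraMap K L A * (v : L) ^ 2 = algebraMap K L C :=
    congr_arg (fun x : K⟮t⟯ => (x : L)) huv
  have := (h.anisotropic_ternary h2 hA).eq_zero_of_mem_adjoin ht (w := ![(u : L), v, 1])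
    (by intro i; fin_cases i; exacts [u.2, v.2, one_mem _])
    (by
      simp only [Fin.sum_univ_three, Matrix.cons_val, map_one, map_neg]
      linear_combination huv')
  simpa using congr_fun this 2

theorem not_sq_adjoin_transcendental {α : K} (hα : ∀ r : K, r ^ 2 ≠ α) {t : L}
    (ht : Transcendental K t) (r : K⟮t⟯) : r ^ 2 ≠ algebraMap K K⟮t⟯ α := by
  intro hr
  have hr' : (r : L) ^ 2 = algebraMap K L α := congr_arg (fun x : K⟮t⟯ => (x : L)) hr
  have := (anisotropic_binary hα one_ne_zero).eq_zero_of_mem_adjoin ht (w := ![(r : L), 1])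
    (by intro i; fin_cases i; exacts [r.2, one_mem _])
    (by
      simp only [Fin.sum_univ_two, Matrix.cons_val, map_one, map_neg, one_mul]
      linear_combination hr')
  simpa using congr_fun this 1

theorem exists_of_mem_adjoin_sqrt {f : K} {s x : L} (hs : s ^ 2 = algebraMap K L f)
    (hx : x ∈ K⟮s⟯) : ∃ u v : K, x = algebraMap K L u + algebraMap K L v * s := by
  have hmonic : (X ^ 2 - Polynomial.C f : K[X]).Monic := monic_X_pow_sub_C f two_ne_zero
  have hroot : aeval s (X ^ 2 - Polynomial.C f : K[X]) = 0 := by simp [hs]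
  have hint : IsIntegral K s := ⟨_, hmonic, hroot⟩
  rw [← mem_toSubalgebra, adjoin_simple_toSubalgebra_of_isAlgebraic hint.isAlgebraic,
    Algebra.adjoin_singleton_eq_range_aeval] at hx
  obtain ⟨p, rfl⟩ := hx
  have hdeg : (p %ₘ (X ^ 2 - Polynomial.C f)).natDegree ≤ 1 := by
    have := natDegree_modByMonic_lt p hmonic (by
      intro h
      have := congr_arg natDegree h
      simp at this)
    rw [natDegree_X_pow_sub_C] at this
    omega
  obtain ⟨a, b, hab⟩ := exists_eq_X_add_C_of_natDegree_le_one hdeg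
  refine ⟨b, a, ?_⟩
  change aeval s p = _
  rw [← aeval_modByMonic_eq_self_of_root hroot, hab]
  simp [add_comm]

/-- A quaternion algebra split by a quadratic extension contains that extension. -/
theorem NotNorm.exists_pure_eq (h : NotNorm A C) (h2 : (2 : K) ≠ 0) {f : K} {s : L}
    (hs : s ^ 2 = algebraMap K L f) {u v : L} (hu : u ∈ K⟮s⟯) (hv : v ∈ K⟮s⟯)
    (huv : u ^ 2 - algebraMap K L A * v ^ 2 = algebraMap K L C) :
    ∃ w p q : K, A * w ^ 2 + C * p ^ 2 - A * C * q ^ 2 = f := by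
  obtain ⟨u₀, u₁, rfl⟩ := exists_of_mem_adjoin_sqrt hs hu
  obtain ⟨v₀, v₁, rfl⟩ := exists_of_mem_adjoin_sqrt hs hv
  have hinj := (algebraMap K L).injective
  by_cases hsK : ∃ s₀, algebraMap K L s₀ = s
  · obtain ⟨s₀, rfl⟩ := hsK
    refine (h (u₀ + u₁ * s₀) (v₀ + v₁ * s₀) (hinj ?_)).elim
    simpa using huv
  -- As `s ∉ K`, the coefficients of `1` and `s` can be compared separately.
  have hlin : 2 * (u₀ * u₁ - A * v₀ * v₁) = 0 := by
    by_contra hne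
    refine hsK ⟨(C - (u₀ ^ 2 - A * v₀ ^ 2 + f * (u₁ ^ 2 - A * v₁ ^ 2))) /
      (2 * (u₀ * u₁ - A * v₀ * v₁)), ?_⟩
    rw [map_div₀, div_eq_iff ((_root_.map_ne_zero _).2 hne)]
    simp only [map_sub, map_add, map_mul, map_pow, map_ofNat]
    linear_combination ((algebraMap K L u₁) ^ 2 - algebraMap K L A * (algebraMap K L v₁) ^ 2) * hs
      - huv
  replace hlin : u₀ * u₁ - A * v₀ * v₁ = 0 := (mul_eq_zero.1 hlin).resolve_left h2
  have hconst : u₀ ^ 2 - A * v₀ ^ 2 + f * (u₁ ^ 2 - A * v₁ ^ 2) = C := by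
    apply hinj
    have hlin' := congr_arg (algebraMap K L) hlin
    simp only [map_sub, map_add, map_mul, map_pow, map_zero] at hlin' ⊢
    linear_combination huv - 2 * s * hlin' -
      ((algebraMap K L u₁) ^ 2 - algebraMap K L A * (algebraMap K L v₁) ^ 2) * hs
  by_cases hN : u₁ ^ 2 - A * v₁ ^ 2 = 0
  · exact (h u₀ v₀ (by rw [← hconst, hN]; ring)).elim
  -- With `Uᵢ = uᵢ + vᵢ√A`, one has `f N(U₁) = C - N(U₀)`, and `hlin` says that `U₀` times the
  -- conjugate of `U₁` is a multiple of `√A`.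
  refine ⟨(v₀ * u₁ - u₀ * v₁) / (u₁ ^ 2 - A * v₁ ^ 2), u₁ / (u₁ ^ 2 - A * v₁ ^ 2),
    v₁ / (u₁ ^ 2 - A * v₁ ^ 2), ?_⟩
  field_simp
  linear_combination -(u₁ ^ 2 - A * v₁ ^ 2) * hconst + (u₀ * u₁ - A * v₀ * v₁) * hlin

/-- A nonsplit quaternion algebra stays nonsplit over the function field of the quadric
`s² = a d y² + b (1 - a v²)` if its discriminant `d` is not a square. -/
theorem NotNorm.quadric (h : NotNorm A C) (h2 : (2 : K) ≠ 0) (hA : A ≠ 0) {a b d : K} (ha : a ≠ 0)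
    (hb : b ≠ 0) (hd : ∀ r : K, r ^ 2 ≠ d) {v y s : L} (hv : Transcendental K v)
    (hy : Transcendental K⟮v⟯ y) {f : K⟮v⟯⟮y⟯}
    (hs : s ^ 2 = f) (hf : (f : L) = algebraMap K L b * (1 - algebraMap K L a * v ^ 2) +
      algebraMap K L (a * d) * y ^ 2) {u₀ u₁ : L}
    (hu₀ : u₀ ∈ K⟮v⟯⟮y⟯⟮s⟯) (hu₁ : u₁ ∈ K⟮v⟯⟮y⟯⟮s⟯) :
    u₀ ^ 2 - algebraMap K L A * u₁ ^ 2 ≠ algebraMap K L C := by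
  intro huv
  have h2₁ : (2 : K⟮v⟯) ≠ 0 := two_ne_zero_of_algebra h2
  have h2₂ : (2 : K⟮v⟯⟮y⟯) ≠ 0 := two_ne_zero_of_algebra h2₁
  have hA₁ : algebraMap K K⟮v⟯ A ≠ 0 := (_root_.map_ne_zero _).2 hA
  have h₁ := h.adjoin_transcendental h2 hA hv
  have h₂ := h₁.adjoin_transcendental h2₁ hA₁ hy
  obtain ⟨w, p, q, hwpq⟩ := h₂.exists_pure_eq h2₂ hs hu₀ hu₁ huv
  have hd0 : d ≠ 0 := fun h => hd 0 (by simp [h])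
  set α := a * d with hα
  have hα0 : α ≠ 0 := mul_ne_zero ha hd0
  let vK : K⟮v⟯ := AdjoinSimple.gen K v
  let β : K⟮v⟯ := algebraMap K K⟮v⟯ b * (1 - algebraMap K K⟮v⟯ a * vK ^ 2)
  -- Cassels–Pfister in `y` separates `f = β + α y²` into orthogonal vectors over `K(v)`.
  obtain ⟨P, Q, hP, hPQ, hQ⟩ := (h₁.anisotropic_pure h2₁ hA₁).exists_orthogonal h2₁ hy
    (a := algebraMap K K⟮v⟯ α) (b := β) (w := ![(w : L), p, q])
    (by intro i; fin_cases i; exacts [w.2, p.2, q.2])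
    (by
      have := (congr_arg (fun x : K⟮v⟯⟮y⟯ => (x : L)) hwpq).trans hf
      simp only [Fin.sum_univ_three, Matrix.cons_val]
      change algebraMap K L A * (w : L) ^ 2 + algebraMap K L C * (p : L) ^ 2 +
        (-(algebraMap K L A * algebraMap K L C)) * (q : L) ^ 2 =
        algebraMap K L b * (1 - algebraMap K L a * v ^ 2) + algebraMap K L α * y ^ 2
      rw [← this]
      change _ = algebraMap K L A * (w : L) ^ 2 + algebraMap K L C * (p : L) ^ 2 -
        (algebraMap K L A * algebraMap K L C) * (q : L) ^ 2
      ring)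
  -- The value `α` is constant in `v`, so it is already represented over `K`.
  obtain ⟨Q₀, -, hQ₀, -, -⟩ := (h.anisotropic_pure h2 hA).exists_orthogonal h2 hv
    (a := 0) (b := α) (w := fun i => (Q i : L)) (fun i => (Q i).2)
    (by
      have := congr_arg (fun x : K⟮v⟯ => (x : L)) hQ
      simp only [Fin.sum_univ_three, Matrix.cons_val] at this ⊢
      rw [map_zero, zero_mul, add_zero]
      refine Eq.trans ?_ this
      simp only [map_neg, map_mul]
      rfl)
  simp only [Fin.sum_univ_three, Matrix.cons_val] at hP hPQ hQ hQ₀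
  have hQ₀' : A * Q₀ 0 ^ 2 + C * Q₀ 1 ^ 2 - A * C * Q₀ 2 ^ 2 = α := by
    linear_combination hQ₀
  have hαsq := h.pure_ne_sq h2 hA hα0 hQ₀'
  obtain ⟨γ, X, Y, Z, hγ, e00, e11, e22, e01, e02, e12⟩ := h.exists_isometry h2 hA hα0 hQ₀'
  let φ := algebraMap K K⟮v⟯
  apply_fun φ at e00 e11 e22 e01 e02 e12
  simp only [map_sub, map_add, map_mul, map_neg, map_zero] at e00 e11 e22 e01 e02 e12
  -- Witt cancellation of `⟨α⟩`: in the coordinates `X`, `Y`, `Z`, the vector `P` is moved into `⟨γ,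
  -- -αγ⟩`.
  obtain ⟨r, t, hrt⟩ := exists_eq_mul_norm_of_orthogonal (α := φ α) (β := β) (γ := φ γ)
    (w₀ := φ (X 0) * P 0 + φ (X 1) * P 1 + φ (X 2) * P 2)
    (p₀ := φ (Y 0) * P 0 + φ (Y 1) * P 1 + φ (Y 2) * P 2)
    (q₀ := φ (Z 0) * P 0 + φ (Z 1) * P 1 + φ (Z 2) * P 2)
    (w₁ := φ (X 0) * Q 0 + φ (X 1) * Q 1 + φ (X 2) * Q 2)
    (p₁ := φ (Y 0) * Q 0 + φ (Y 1) * Q 1 + φ (Y 2) * Q 2)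
    (q₁ := φ (Z 0) * Q 0 + φ (Z 1) * Q 1 + φ (Z 2) * Q 2)
    (not_sq_adjoin_transcendental hαsq hv) ((_root_.map_ne_zero _).2 hγ)
    (by linear_combination P 0 ^ 2 * e00 + P 1 ^ 2 * e11 + P 2 ^ 2 * e22 + 2 * P 0 * P 1 * e01 +
          2 * P 0 * P 2 * e02 + 2 * P 1 * P 2 * e12 + hP)
    (by linear_combination Q 0 ^ 2 * e00 + Q 1 ^ 2 * e11 + Q 2 ^ 2 * e22 + 2 * Q 0 * Q 1 * e01 +
          2 * Q 0 * Q 2 * e02 + 2 * Q 1 * Q 2 * e12 + hQ)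
    (by linear_combination P 0 * Q 0 * e00 + P 1 * Q 1 * e11 + P 2 * Q 2 * e22 +
          (P 0 * Q 1 + P 1 * Q 0) * e01 + (P 0 * Q 2 + P 2 * Q 0) * e02 +
          (P 1 * Q 2 + P 2 * Q 1) * e12 + hPQ)
  obtain ⟨R, S, hR, hRS, hS⟩ := (anisotropic_binary hαsq hγ).exists_orthogonal h2 hv
    (a := -(a * b)) (b := b) (w := ![(r : L), t])
    (by intro i; fin_cases i; exacts [r.2, t.2])
    (by
      have : algebraMap K L γ * ((r : L) ^ 2 - algebraMap K L α * (t : L) ^ 2) =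
        algebraMap K L b * (1 - algebraMap K L a * v ^ 2) :=
        congr_arg (fun x : K⟮v⟯ => (x : L)) hrt
      simp only [Fin.sum_univ_two, Matrix.cons_val, map_neg, map_mul] at this ⊢
      linear_combination this)
  simp only [Fin.sum_univ_two, Matrix.cons_val] at hR hRS hS
  set D := R 0 * S 1 - R 1 * S 0 with hD
  -- Gram determinants: `R` and `S` are orthogonal of values `b` and `-ab` in a binary form of
  -- determinant `-γ²α`, and `α = a d`.
  have hdet : d * (γ * D) ^ 2 = b ^ 2 := by
    apply mul_left_cancel₀ ha
    rw [← mul_assoc, ← hα, hD]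
    linear_combination -b * hS - (γ * S 0 ^ 2 + -(γ * α) * S 1 ^ 2) * hR +
      (γ * (R 0 * S 0) - γ * α * (R 1 * S 1)) * hRS
  have hγD : γ * D ≠ 0 := fun h => hb (by rw [h] at hdet; simpa using hdet.symm)
  refine hd (b / (γ * D)) ?_
  rw [div_pow, div_eq_iff (pow_ne_zero 2 hγD), hdet]

end Extension

/-! ### The tower of countable subfields of `ℂ` -/

section Construction

open IntermediateField

theorem countable_adjoin_simple {K L : Type*} [Field K] [Field L] [Algebra K L] [Countable K]
    (t : L) : Countable K⟮t⟯ := by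
  have : Countable K[X] := by
    rw [← Cardinal.mk_le_aleph0_iff]
    exact Polynomial.cardinalMk_le_max.trans (by simp)
  have hsub : (K⟮t⟯ : Set L) ⊆ Set.range fun p : K[X] × K[X] => aeval t p.1 / aeval t p.2 := by
    intro x hx
    obtain ⟨r, s, h⟩ := (mem_adjoin_simple_iff K _).1 hx
    exact ⟨(r, s), h.symm⟩
  exact ((Set.countable_range _).mono hsub).to_subtype

theorem exists_transcendental_complex (K : Type*) [Field K] [Algebra K ℂ] [Countable K] :
    ∃ t : ℂ, Transcendental K t := by
  by_contra! h
  have hall : {x : ℂ | IsAlgebraic K x} = Set.univ :=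
    Set.eq_univ_of_forall fun x => by simpa [Transcendental] using h x
  have := Algebraic.countable K ℂ
  rw [hall] at this
  exact not_countable_complex this

/-- Countable subfields of `ℂ` over which no quaternion algebra `(-1, c / ℚ)` gets split that was
not split over `ℚ`. -/
def PreservesNonsplit (K : Subfield ℂ) : Prop :=
  Countable K ∧ ∀ c : ℚ, NotNorm (-1) c → NotNorm (-1 : K) (c : K)

/-- Over `K`, either `d` is a square or `(a, b / K)` contains a pure quaternion of square `d`. -/
def RepresentsOrSquare (K : Subfield ℂ) (a b d : ℂ) : Prop :=
  (∃ r ∈ K, r ^ 2 = d) ∨ ∃ x ∈ K, ∃ y ∈ K, ∃ z ∈ K, a * x ^ 2 + b * y ^ 2 - a * b * z ^ 2 = d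

theorem RepresentsOrSquare.mono {K K' : Subfield ℂ} (hle : K ≤ K') {a b d : ℂ}
    (h : RepresentsOrSquare K a b d) : RepresentsOrSquare K' a b d := by
  rcases h with ⟨r, hr, h⟩ | ⟨x, hx, y, hy, z, hz, h⟩
  · exact Or.inl ⟨r, hle hr, h⟩
  · exact Or.inr ⟨x, hle hx, y, hle hy, z, hle hz, h⟩

/-- Adjoin a generic point of the quadric. Countability leaves room in `ℂ` for the transcendentals,
and `NotNorm.quadric` applies because `d` is not a square. -/
theorem PreservesNonsplit.exists_representsOrSquare {K : Subfield ℂ} (hK : PreservesNonsplit K)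
    {a b d : ℂ} (ha : a ∈ K) (hb : b ∈ K) (hd : d ∈ K) (ha0 : a ≠ 0) (hb0 : b ≠ 0) :
    ∃ K', K ≤ K' ∧ PreservesNonsplit K' ∧ RepresentsOrSquare K' a b d := by
  by_cases hsq : ∃ r ∈ K, r ^ 2 = d
  · exact ⟨K, le_rfl, hK, Or.inl hsq⟩
  obtain ⟨hcount, hnorm⟩ := hK
  obtain ⟨v, hv⟩ := exists_transcendental_complex K
  have := countable_adjoin_simple (K := K) v
  obtain ⟨y, hy⟩ := exists_transcendental_complex K⟮v⟯
  have := countable_adjoin_simple (K := K⟮v⟯) y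
  obtain ⟨s, hs⟩ := IsAlgClosed.exists_pow_nat_eq (b * (1 - a * v ^ 2) + a * d * y ^ 2) two_pos
  have := countable_adjoin_simple (K := K⟮v⟯⟮y⟯) s
  have h₁ : ∀ x ∈ K, x ∈ K⟮v⟯ := fun x hx => K⟮v⟯.algebraMap_mem ⟨x, hx⟩
  have h₂ : ∀ x ∈ K⟮v⟯, x ∈ K⟮v⟯⟮y⟯ := fun x hx => K⟮v⟯⟮y⟯.algebraMap_mem ⟨x, hx⟩
  have h₃ : ∀ x ∈ K⟮v⟯⟮y⟯, x ∈ K⟮v⟯⟮y⟯⟮s⟯ := fun x hx => K⟮v⟯⟮y⟯⟮s⟯.algebraMap_mem ⟨x, hx⟩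
  have hvm : v ∈ K⟮v⟯ := mem_adjoin_simple_self _ _
  have hym : y ∈ K⟮v⟯⟮y⟯ := mem_adjoin_simple_self _ _
  have hsm : s ∈ K⟮v⟯⟮y⟯⟮s⟯ := mem_adjoin_simple_self _ _
  have hf : b * (1 - a * v ^ 2) + a * d * y ^ 2 ∈ K⟮v⟯⟮y⟯ := by
    refine add_mem (h₂ _ (mul_mem (h₁ _ hb) (sub_mem (one_mem _) (mul_mem (h₁ _ ha)
      (pow_mem hvm 2))))) (mul_mem (h₂ _ (h₁ _ (mul_mem ha hd))) (pow_mem hym 2))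
  refine ⟨K⟮v⟯⟮y⟯⟮s⟯.toSubfield, fun x hx => h₃ _ (h₂ _ (h₁ _ hx)), ⟨this, fun c hc u w huw => ?_⟩,
    Or.inr ?_⟩
  · have hu : (u : ℂ) ^ 2 - (-1) * (w : ℂ) ^ 2 = (c : ℂ) := by
      have := congr_arg (algebraMap K⟮v⟯⟮y⟯⟮s⟯.toSubfield ℂ) huw
      simp only [map_sub, map_mul, map_neg, map_one, map_pow, map_ratCast] at this
      exact this
    refine (hnorm c hc).quadric two_ne_zero (by simp) (a := ⟨a, ha⟩) (b := ⟨b, hb⟩) (d := ⟨d, hd⟩)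
      (fun h => ha0 (congr_arg Subtype.val h)) (fun h => hb0 (congr_arg Subtype.val h))
      (fun r hr => hsq ⟨r, r.2, congr_arg Subtype.val hr⟩) hv hy
      (f := ⟨_, hf⟩) hs rfl u.2 w.2 ?_
    refine Eq.trans ?_ (hu.trans ?_)
    · simp
    · simp
  · have hy0 : y ≠ 0 := by
      rintro rfl
      exact hy isAlgebraic_zero
    have hym' := h₃ _ hym
    have ham := h₃ _ (h₂ _ (h₁ _ ha))
    refine ⟨s / (a * y), div_mem hsm (mul_mem ham hym'), v / y, div_mem (h₃ _ (h₂ _ hvm)) hym',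
      1 / (a * y), div_mem (one_mem _) (mul_mem ham hym'), ?_⟩
    field_simp
    linear_combination hs

theorem PreservesNonsplit.iSup {K : ℕ → Subfield ℂ} (hK : ∀ n, PreservesNonsplit (K n))
    (hmono : Monotone K) : PreservesNonsplit (⨆ n, K n) := by
  have hmem : ∀ {x}, x ∈ ⨆ n, K n ↔ ∃ n, x ∈ K n :=
    Subfield.mem_iSup_of_directed hmono.directed_le
  constructor
  · have : ((⨆ n, K n : Subfield ℂ) : Set ℂ) ⊆ ⋃ n, (K n : Set ℂ) := fun x hx =>
      Set.mem_iUnion.2 (hmem.1 hx)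
    exact ((Set.countable_iUnion fun n => (hK n).1.to_set).mono this).to_subtype
  · rintro c hc ⟨u, hu⟩ ⟨v, hv⟩ huv
    obtain ⟨m, hm⟩ := hmem.1 hu
    obtain ⟨n, hn⟩ := hmem.1 hv
    refine (hK (max m n)).2 c hc ⟨u, hmono (le_max_left _ _) hm⟩ ⟨v, hmono (le_max_right _ _) hn⟩ ?_
    have := congr_arg Subtype.val huv
    apply Subtype.ext
    simpa using this

/-- Dependent choice for increasing sequences of subfields. -/
theorem PreservesNonsplit.exists_seq {R : ℕ → Subfield ℂ → Subfield ℂ → Prop}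
    (hR : ∀ n K, PreservesNonsplit K → ∃ K', K ≤ K' ∧ PreservesNonsplit K' ∧ R n K K')
    {K : Subfield ℂ} (hK : PreservesNonsplit K) :
    ∃ F : ℕ → Subfield ℂ, F 0 = K ∧ Monotone F ∧ (∀ n, PreservesNonsplit (F n)) ∧
      ∀ n, R n (F n) (F (n + 1)) := by
  choose g hle hg hRg using fun n (K : {K // PreservesNonsplit K}) => hR n K.1 K.2
  let F : ℕ → {K // PreservesNonsplit K} :=
    fun n => Nat.rec ⟨K, hK⟩ (fun n K => ⟨g n K, hg n K⟩) n
  exact ⟨fun n => (F n).1, rfl, monotone_nat_of_le_succ fun n => hle n (F n), fun n => (F n).2,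
    fun n => hRg n (F n)⟩

/-- Triples from the countable field `K` are treated one by one. Elements added along the way are
not covered, so this step must itself be iterated. -/
theorem PreservesNonsplit.exists_forall_representsOrSquare {K : Subfield ℂ}
    (hK : PreservesNonsplit K) : ∃ K', K ≤ K' ∧ PreservesNonsplit K' ∧
      ∀ a ∈ K, ∀ b ∈ K, ∀ d ∈ K, a ≠ 0 → b ≠ 0 → RepresentsOrSquare K' a b d := by
  have := hK.1
  obtain ⟨e, he⟩ := exists_surjective_nat (K × K × K)
  obtain ⟨F, hF0, hmono, hF, hR⟩ := hK.exists_seq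
    -- The guard `K ≤ L` is needed because the choice step sees an arbitrary `L`; along the chain it
    -- holds automatically.
    (R := fun n L L' => K ≤ L → (e n).1 ≠ 0 → (e n).2.1 ≠ 0 →
      RepresentsOrSquare L' (e n).1 (e n).2.1 (e n).2.2) fun n L hL => by
    by_cases h : K ≤ L ∧ (e n).1 ≠ 0 ∧ (e n).2.1 ≠ 0
    · obtain ⟨hKL, h0, h1⟩ := h
      obtain ⟨L', h⟩ := hL.exists_representsOrSquare (hKL (e n).1.2) (hKL (e n).2.1.2)
        (hKL (e n).2.2.2) (fun h => h0 (Subtype.ext h)) (fun h => h1 (Subtype.ext h))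
      exact ⟨L', h.1, h.2.1, fun _ _ _ => h.2.2⟩
    · exact ⟨L, le_rfl, hL, fun h1 h2 h3 => (h ⟨h1, h2, h3⟩).elim⟩
  refine ⟨⨆ n, F n, hF0 ▸ le_iSup F 0, .iSup hF hmono, fun a ha b hb d hd ha0 hb0 => ?_⟩
  obtain ⟨n, hn⟩ := he (⟨a, ha⟩, ⟨b, hb⟩, ⟨d, hd⟩)
  have := hR n (hF0 ▸ hmono (Nat.zero_le n))
  rw [hn] at this
  exact (this (fun h => ha0 (congr_arg Subtype.val h))
    fun h => hb0 (congr_arg Subtype.val h)).mono (le_iSup F (n + 1))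

theorem preservesNonsplit_bot : PreservesNonsplit ⊥ := by
  have hmem : ∀ x ∈ (⊥ : Subfield ℂ), ∃ q : ℚ, (q : ℂ) = x := fun x hx => by
    have : (⊥ : Subfield ℂ) ≤ (algebraMap ℚ ℂ).fieldRange := bot_le
    simpa using this hx
  constructor
  · have : ((⊥ : Subfield ℂ) : Set ℂ) ⊆ Set.range fun q : ℚ => (q : ℂ) := fun x hx => hmem x hx
    exact ((Set.countable_range _).mono this).to_subtype
  · rintro c hc ⟨u, hu⟩ ⟨v, hv⟩ huv
    obtain ⟨u, rfl⟩ := hmem u hu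
    obtain ⟨v, rfl⟩ := hmem v hv
    refine hc u v ?_
    have := congr_arg Subtype.val huv
    have h : ((u ^ 2 - (-1) * v ^ 2 : ℚ) : ℂ) = (c : ℂ) := by
      push_cast
      simpa using this
    exact_mod_cast h

/-- There is a field containing `ℚ`, over which the nonsplit algebras `(-1, c / ℚ)` stay nonsplit,
and such that every quadratic extension embeds into every quaternion algebra. -/
theorem exists_field_forall_pure_represents : ∃ K : Subfield ℂ,
    (∀ c : ℚ, NotNorm (-1) c → NotNorm (-1 : K) (c : K)) ∧
    ∀ a b d : K, a ≠ 0 → b ≠ 0 → (∀ r : K, r ^ 2 ≠ d) →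
      ∃ x y z : K, a * x ^ 2 + b * y ^ 2 - a * b * z ^ 2 = d := by
  obtain ⟨F, -, hmono, hF, hR⟩ := preservesNonsplit_bot.exists_seq
    fun _ _ hK => hK.exists_forall_representsOrSquare
  refine ⟨⨆ n, F n, (PreservesNonsplit.iSup hF hmono).2, ?_⟩
  rintro ⟨a, ha⟩ ⟨b, hb⟩ ⟨d, hd⟩ ha0 hb0 hsq
  have hmem : ∀ {x}, x ∈ ⨆ n, F n ↔ ∃ n, x ∈ F n :=
    Subfield.mem_iSup_of_directed hmono.directed_le
  obtain ⟨l, hl⟩ := hmem.1 ha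
  obtain ⟨m, hm⟩ := hmem.1 hb
  obtain ⟨n, hn⟩ := hmem.1 hd
  have h := (hR (max l (max m n)) a (hmono (le_max_left _ _) hl)
    b (hmono ((le_max_left _ _).trans (le_max_right _ _)) hm)
    d (hmono ((le_max_right _ _).trans (le_max_right _ _)) hn)
    (fun h => ha0 (Subtype.ext h)) (fun h => hb0 (Subtype.ext h))).mono (le_iSup F _)
  rcases h with ⟨r, hr, h⟩ | ⟨x, hx, y, hy, z, hz, h⟩
  · exact (hsq ⟨r, hr⟩ (Subtype.ext h)).elim
  · exact ⟨⟨x, hx⟩, ⟨y, hy⟩, ⟨z, hz⟩, Subtype.ext h⟩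

end Construction

/-! ### Nonsplit algebras over `ℚ` -/

section RationalNumbers

/-- Clearing denominators would make `n` times a square a sum of two squares, where primes `3 mod 4`
occur to even powers. -/
theorem notNorm_neg_one_of_odd_padicValNat {n p : ℕ} (hp : p.Prime) (hp4 : p % 4 = 3)
    (hodd : Odd (padicValNat p n)) : NotNorm (-1 : ℚ) n := by
  intro u v huv
  have := Fact.mk hp
  have hn : n ≠ 0 := by rintro rfl; simp at hodd
  have hD : u.den * v.den ≠ 0 := mul_ne_zero u.den_ne_zero v.den_ne_zero
  have hsum : n * (u.den * v.den) ^ 2 =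
      (u.num * v.den).natAbs ^ 2 + (v.num * u.den).natAbs ^ 2 := by
    zify
    simp only [sq_abs]
    have hu : (u.num : ℚ) = u * u.den := (Rat.mul_den_eq_num u).symm
    have hv : (v.num : ℚ) = v * v.den := (Rat.mul_den_eq_num v).symm
    have : (n * (u.den * v.den) ^ 2 : ℚ) = (u.num * v.den) ^ 2 + (v.num * u.den) ^ 2 := by
      rw [hu, hv, ← huv]
      ring
    exact_mod_cast this
  have hval : padicValNat p (n * (u.den * v.den) ^ 2) =
      padicValNat p n + 2 * padicValNat p (u.den * v.den) := by
    rw [padicValNat.mul hn (pow_ne_zero 2 hD), padicValNat.pow]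
  have heven := Nat.eq_sq_add_sq_iff.1 ⟨_, _, hsum⟩ p
    (by
      refine Nat.mem_primeFactors.2 ⟨hp, ?_, mul_ne_zero hn (pow_ne_zero 2 hD)⟩
      exact (dvd_of_one_le_padicValNat hodd.pos).mul_right _) hp4
  rw [hval] at heven
  exact Nat.not_even_iff_odd.2 (hodd.add_even (even_two_mul _)) heven

end RationalNumbers

/-! ### Computations in quaternion algebras -/

section Quaternion

variable {K : Type*} [Field K] {a b c : K}

theorem NotNorm.isUnit_or_eq_zero (h : NotNorm a b) (h2 : (2 : K) ≠ 0) (ha : a ≠ 0)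
    (x : ℍ[K,a,b]) : IsUnit x ∨ x = 0 := by
  by_cases hN : x.re ^ 2 - a * x.imI ^ 2 - b * x.imJ ^ 2 + a * b * x.imK ^ 2 = 0
  · right
    obtain ⟨⟨hJ, hK⟩, hr, hI⟩ := h.eq_zero_of_mul_eq h2 ha (p := x.imJ) (q := x.imK) (s := x.re)
      (w := x.imI) (by linear_combination -hN)
    ext <;> simpa
  · left
    set N := x.re ^ 2 - a * x.imI ^ 2 - b * x.imJ ^ 2 + a * b * x.imK ^ 2 with hN'
    refine isUnit_iff_exists.2
      ⟨⟨x.re / N, -x.imI / N, -x.imJ / N, -x.imK / N⟩, ?_, ?_⟩ <;>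
    · ext <;> simp <;> field_simp <;> simp only [hN'] <;> ring

/-- By an explicit Skolem–Noether argument the image of `i` may be taken to be `i`; the image of `j`
then anticommutes with `i`, so it lies in the span of `j` and `ij`. -/
theorem QuaternionAlgebra.exists_norm_of_algEquiv (hc : NotNorm a c) (h2 : (2 : K) ≠ 0)
    (ha : a ≠ 0) (e : ℍ[K,a,b] ≃ₐ[K] ℍ[K,a,c]) : ∃ r s : K, r ^ 2 - a * s ^ 2 = b * c := by
  set I := e ⟨0, 1, 0, 0⟩ with hI
  set J := e ⟨0, 0, 1, 0⟩ with hJ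
  let i : ℍ[K,a,c] := ⟨0, 1, 0, 0⟩
  have hi : i * i = algebraMap K _ a := by
    rw [QuaternionAlgebra.algebraMap_eq]
    ext <;> simp [i]
  have hII : I * I = algebraMap K _ a := by
    rw [hI, ← map_mul, ← e.commutes, QuaternionAlgebra.algebraMap_eq]
    congr 1
    ext <;> simp
  have hJJ : J * J = algebraMap K _ b := by
    rw [hJ, ← map_mul, ← e.commutes, QuaternionAlgebra.algebraMap_eq]
    congr 1
    ext <;> simp
  have hIJ : J * I = -(I * J) := by
    rw [hI, hJ, ← map_mul, ← map_mul, ← map_neg]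
    congr 1
    ext <;> simp
  obtain ⟨g, hg, hgI⟩ : ∃ g : ℍ[K,a,c], IsUnit g ∧ i * g = g * I := by
    -- As `i² = I²`, the element `i + I` intertwines them; if it vanishes, then `I = -i` and `j`
    -- does.
    rcases hc.isUnit_or_eq_zero h2 ha (i + I) with hg | hg
    · exact ⟨i + I, hg, by rw [mul_add, add_mul, hi, hII, add_comm]⟩
    · refine ⟨⟨0, 0, 1, 0⟩, (hc.isUnit_or_eq_zero h2 ha _).resolve_right fun h => ?_, ?_⟩
      · simpa using congr_arg QuaternionAlgebra.imJ h
      · rw [eq_neg_of_add_eq_zero_right hg]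
        ext <;> simp [i]
  obtain ⟨g, rfl⟩ := hg
  set x : ℍ[K,a,c] := g * J * ↑g⁻¹ with hx
  have hgi : (↑g⁻¹ : ℍ[K,a,c]) * i = I * ↑g⁻¹ := by
    rw [Units.inv_mul_eq_iff_eq_mul, ← mul_assoc, ← hgI, mul_assoc, Units.mul_inv, mul_one]
  have hxx : x * x = algebraMap K _ b := by
    calc x * x = g * (J * J) * ↑g⁻¹ := by simp [hx, mul_assoc]
      _ = algebraMap K _ b := by
        rw [hJJ, ← Algebra.commutes, mul_assoc, Units.mul_inv, mul_one]
  have hxi : x * i = -(i * x) := by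
    calc x * i = g * (J * I) * ↑g⁻¹ := by rw [hx, mul_assoc, hgi]; simp [mul_assoc]
      _ = -(g * I * J * ↑g⁻¹) := by rw [hIJ]; simp [mul_assoc]
      _ = -(i * x) := by rw [← hgI, hx]; simp [mul_assoc]
  have hre := congr_arg QuaternionAlgebra.imI hxi
  have him := congr_arg QuaternionAlgebra.re hxi
  simp [i] at hre him
  have hre0 : x.re = 0 := by
    have : 2 * x.re = 0 := by linear_combination hre
    simpa [h2] using this
  have him0 : x.imI = 0 := by
    have : 2 * a * x.imI = 0 := by linear_combination him
    simpa [h2, ha] using this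
  have hsq := congr_arg QuaternionAlgebra.re hxx
  rw [QuaternionAlgebra.algebraMap_eq] at hsq
  simp [hre0, him0] at hsq
  exact ⟨c * x.imJ, c * x.imK, by linear_combination c * hsq⟩

/-- The commutator is, up to nonzero scalars, the cross product of the pure parts, so commuting
elements have parallel pure parts. -/
theorem QuaternionAlgebra.exists_eq_of_commute (h2 : (2 : K) ≠ 0) (ha : a ≠ 0) (hb : b ≠ 0)
    {x y : ℍ[K,a,b]} (hxy : x * y = y * x) (hy : y ∉ Set.range (algebraMap K ℍ[K,a,b])) :
    ∃ r s : K, x = r • 1 + s • y := by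
  have h1 := congr_arg QuaternionAlgebra.imI hxy
  have h2' := congr_arg QuaternionAlgebra.imJ hxy
  have h3 := congr_arg QuaternionAlgebra.imK hxy
  simp at h1 h2' h3
  have e1 : x.imJ * y.imK = x.imK * y.imJ := by
    apply mul_left_cancel₀ (mul_ne_zero h2 hb)
    linear_combination -h1
  have e2 : x.imI * y.imK = x.imK * y.imI := by
    apply mul_left_cancel₀ (mul_ne_zero h2 ha)
    linear_combination h2'
  have e3 : x.imI * y.imJ = x.imJ * y.imI := by
    apply mul_left_cancel₀ h2
    linear_combination h3
  suffices ∃ s, x.imI = s * y.imI ∧ x.imJ = s * y.imJ ∧ x.imK = s * y.imK by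
    obtain ⟨s, hI, hJ, hK⟩ := this
    refine ⟨x.re - s * y.re, s, ?_⟩
    ext <;> simp [*]
  by_cases hI : y.imI = 0
  · by_cases hJ : y.imJ = 0
    · by_cases hK : y.imK = 0
      · refine (hy ⟨y.re, ?_⟩).elim
        rw [QuaternionAlgebra.algebraMap_eq]
        ext <;> simp [*]
      · refine ⟨x.imK / y.imK, ?_, ?_, ?_⟩ <;> field_simp <;> assumption
    · refine ⟨x.imJ / y.imJ, ?_, ?_, ?_⟩ <;> field_simp <;> first | assumption | exact e1.symm
  · refine ⟨x.imI / y.imI, ?_, ?_, ?_⟩ <;> field_simp <;> first | exact e3.symm | exact e2.symm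

end Quaternion

/-! ### Maximal subfields are quadratic -/

section MaximalSubfields

variable {K D : Type*} [Field K] [DivisionRing D] [Algebra K D]

theorem IsQuaternionAlgebra.exists_eq_of_commute (hD : IsQuaternionAlgebra K D) (h2 : (2 : K) ≠ 0)
    {x y : D} (hxy : x * y = y * x) (hy : y ∉ Set.range (algebraMap K D)) :
    ∃ r s : K, x = r • 1 + s • y := by
  obtain ⟨a, b, ha, hb, ⟨e⟩⟩ := hD
  obtain ⟨r, s, hrs⟩ := QuaternionAlgebra.exists_eq_of_commute h2 ha hb (x := e x) (y := e y)
    (by rw [← map_mul, hxy, map_mul]) (by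
      rintro ⟨r, hr⟩
      exact hy ⟨r, e.injective (by rw [← hr, e.commutes])⟩)
  exact ⟨r, s, e.injective (by rw [hrs]; simp)⟩

theorem notMem_range_algebraMap_of_sq {d : K} (hd : ∀ r : K, r ^ 2 ≠ d) {θ : D}
    (hθ : θ * θ = d • 1 + (0 : K) • θ) : θ ∉ Set.range (algebraMap K D) := by
  rintro ⟨r, rfl⟩
  refine hd r ((algebraMap K D).injective ?_)
  rw [pow_two, map_mul, hθ, Algebra.algebraMap_eq_smul_one d, zero_smul, add_zero]

/-- Subtracting the scalar part leaves a pure quaternion; were its square `s²` with `s ∈ K`, it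
would be `±s` in a division ring. The zero linear term matches `QuadraticAlgebra K d 0`. -/
theorem IsQuaternionAlgebra.exists_sub_sq (hD : IsQuaternionAlgebra K D)
    {y : D} (hy : y ∉ Set.range (algebraMap K D)) :
    ∃ r d : K, (∀ s : K, s ^ 2 ≠ d) ∧
      (y - algebraMap K D r) * (y - algebraMap K D r) =
        d • 1 + (0 : K) • (y - algebraMap K D r) := by
  obtain ⟨a, b, ha, hb, ⟨e⟩⟩ := hD
  obtain ⟨r, d, hrd⟩ : ∃ r d : K, (y - algebraMap K D r) * (y - algebraMap K D r) =
      algebraMap K D d := by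
    refine ⟨(e y).re, a * (e y).imI ^ 2 + b * (e y).imJ ^ 2 - a * b * (e y).imK ^ 2,
      e.injective ?_⟩
    rw [map_mul, map_sub, e.commutes, e.commutes, QuaternionAlgebra.algebraMap_eq,
      QuaternionAlgebra.algebraMap_eq]
    ext <;> simp <;> ring
  refine ⟨r, d, ?_, by rw [hrd, zero_smul, add_zero, Algebra.algebraMap_eq_smul_one]⟩
  rintro s rfl
  have hcomm : Commute (y - algebraMap K D r) (algebraMap K D s) :=
    (Algebra.commutes s _).symm
  rw [map_pow, ← pow_two, hcomm.sq_eq_sq_iff_eq_or_eq_neg] at hrd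
  rcases hrd with h | h
  · exact hy ⟨r + s, by rw [map_add, ← h, add_sub_cancel]⟩
  · exact hy ⟨r - s, by rw [map_sub, sub_eq_add_neg, ← h, add_sub_cancel]⟩

theorem isField_range_lift {d : K} (hd : ∀ r : K, r ^ 2 ≠ d) {θ : D}
    (hθ : θ * θ = d • 1 + (0 : K) • θ) :
    Nonempty (QuadraticAlgebra K d 0 ≃ₐ[K] (QuadraticAlgebra.lift ⟨θ, hθ⟩).range) ∧
      IsField (QuadraticAlgebra.lift ⟨θ, hθ⟩).range := by
  have : Fact (∀ r : K, r ^ 2 ≠ d + 0 * r) := ⟨by simpa using hd⟩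
  let f : QuadraticAlgebra K d 0 →ₐ[K] D := QuadraticAlgebra.lift ⟨θ, hθ⟩
  let e : QuadraticAlgebra K d 0 ≃ₐ[K] f.range := AlgEquiv.ofInjective f f.toRingHom.injective
  exact ⟨⟨e⟩, e.symm.toMulEquiv.isField (Field.toIsField _)⟩

/-- A larger field would commute with `θ`, whose centralizer is only `K + Kθ`. -/
theorem IsQuaternionAlgebra.isMaximalSubfield_range_lift (hD : IsQuaternionAlgebra K D)
    (h2 : (2 : K) ≠ 0) {d : K} (hd : ∀ r : K, r ^ 2 ≠ d) {θ : D}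
    (hθ : θ * θ = d • 1 + (0 : K) • θ) :
    IsMaximalSubfield K (QuadraticAlgebra.lift ⟨θ, hθ⟩).range := by
  refine ⟨(isField_range_lift hd hθ).2, fun F hF hle x hx => ?_⟩
  have hθF : θ ∈ F := hle ⟨⟨0, 1⟩, by simp⟩
  obtain ⟨r, s, rfl⟩ := hD.exists_eq_of_commute h2
    (congr_arg Subtype.val (hF.mul_comm ⟨x, hx⟩ ⟨θ, hθF⟩)) (notMem_range_algebraMap_of_sq hd hθ)
  exact ⟨⟨r, s⟩, by simp⟩

theorem IsQuaternionAlgebra.exists_eq_range_lift (hD : IsQuaternionAlgebra K D)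
    (h2 : (2 : K) ≠ 0) {E : Subalgebra K D} (hE : IsMaximalSubfield K E) :
    ∃ d : K, (∀ r : K, r ^ 2 ≠ d) ∧ ∃ (θ : D) (hθ : θ * θ = d • 1 + (0 : K) • θ),
      E = (QuadraticAlgebra.lift ⟨θ, hθ⟩).range := by
  have hy : ∃ y ∈ E, y ∉ Set.range (algebraMap K D) := by
    by_contra! hall
    obtain ⟨y, hy⟩ : ∃ y : D, y ∉ Set.range (algebraMap K D) := by
      obtain ⟨a, b, ha, hb, ⟨e⟩⟩ := hD
      refine ⟨e.symm ⟨0, 1, 0, 0⟩, ?_⟩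
      rintro ⟨r, hr⟩
      rw [e.eq_symm_apply, e.commutes, QuaternionAlgebra.algebraMap_eq] at hr
      simpa using congr_arg QuaternionAlgebra.imI hr
    obtain ⟨r, d, hd, hθ⟩ := hD.exists_sub_sq hy
    have hle : E ≤ (QuadraticAlgebra.lift ⟨_, hθ⟩).range := fun x hx => by
      obtain ⟨s, rfl⟩ := hall x hx
      exact Subalgebra.algebraMap_mem _ s
    have hmem := hE.2 (isField_range_lift hd hθ).2 hle
      (⟨⟨r, 1⟩, by simp [Algebra.algebraMap_eq_smul_one]⟩ :
        y ∈ (QuadraticAlgebra.lift ⟨_, hθ⟩).range)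
    exact hy (hall y hmem)
  obtain ⟨y, hyE, hy⟩ := hy
  obtain ⟨r, d, hd, hθ⟩ := hD.exists_sub_sq hy
  have hθE : y - algebraMap K D r ∈ E := sub_mem hyE (E.algebraMap_mem r)
  have hle : (QuadraticAlgebra.lift ⟨_, hθ⟩).range ≤ E := by
    rintro _ ⟨z, rfl⟩
    have : z.re • (1 : D) + z.im • (y - algebraMap K D r) ∈ E :=
      add_mem (E.smul_mem (one_mem _) _) (E.smul_mem hθE _)
    simpa using this
  exact ⟨d, hd, _, hθ, le_antisymm
    ((hD.isMaximalSubfield_range_lift h2 hd hθ).2 hE.1 hle) hle⟩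

theorem IsQuaternionAlgebra.exists_isMaximalSubfield_algEquiv {D' : Type*} [DivisionRing D']
    [Algebra K D'] (hD : IsQuaternionAlgebra K D) (hD' : IsQuaternionAlgebra K D')
    (h2 : (2 : K) ≠ 0)
    (hrep : ∀ a b d : K, a ≠ 0 → b ≠ 0 → (∀ r : K, r ^ 2 ≠ d) →
      ∃ x y z : K, a * x ^ 2 + b * y ^ 2 - a * b * z ^ 2 = d)
    {E : Subalgebra K D} (hE : IsMaximalSubfield K E) :
    ∃ E' : Subalgebra K D', IsMaximalSubfield K E' ∧ Nonempty (E ≃ₐ[K] E') := by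
  obtain ⟨d, hd, θ, hθ, rfl⟩ := hD.exists_eq_range_lift h2 hE
  obtain ⟨θ', hθ'⟩ : ∃ θ' : D', θ' * θ' = d • 1 + (0 : K) • θ' := by
    obtain ⟨a, b, ha, hb, ⟨e⟩⟩ := hD'
    obtain ⟨x, y, z, h⟩ := hrep a b d ha hb hd
    refine ⟨e.symm ⟨0, x, y, z⟩, e.injective ?_⟩
    rw [zero_smul, add_zero, ← Algebra.algebraMap_eq_smul_one, e.commutes, map_mul,
      e.apply_symm_apply, QuaternionAlgebra.algebraMap_eq]
    ext <;> simp [← h] <;> ring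
  obtain ⟨⟨e⟩, -⟩ := isField_range_lift hd hθ
  obtain ⟨⟨e'⟩, -⟩ := isField_range_lift hd hθ'
  exact ⟨_, hD'.isMaximalSubfield_range_lift h2 hd hθ', ⟨e.symm.trans e'⟩⟩

end MaximalSubfields

/-! ### Assembling the theorem -/

/-- The quaternion division algebra `(a, b / K)` for `b` not a norm from `K(√a)`. -/
noncomputable def NotNorm.quatDivAlg {K : Type} [Field K] {a b : K} (h : NotNorm a b)
    (h2 : (2 : K) ≠ 0) (ha : a ≠ 0) : QuatDivAlg K :=
  letI : DivisionRing ℍ[K,a,b] := .ofIsUnitOrEqZero (h.isUnit_or_eq_zero h2 ha)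
  { carrier := ℍ[K,a,b]
    algebra := QuaternionAlgebra.instAlgebra
    isQuaternionAlgebra := ⟨a, b, ha, fun hb => h 0 0 (by simp [hb]), ⟨AlgEquiv.refl⟩⟩ }

theorem theoremC :
    ∃ (K : Type) (_ : Field K), ringChar K ≠ 2 ∧
      Infinite (QuatStar K) ∧
      ∀ D D' : QuatDivAlg K, WeaklyIsomorphic K D D' := by
  obtain ⟨K, hnorm, hrep⟩ := exists_field_forall_pure_represents
  have h2 : (2 : K) ≠ 0 := two_ne_zero
  refine ⟨K, inferInstance, by rw [ringChar.eq_zero]; decide, ?_, fun D D' => ⟨fun E hE => ?_,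
    fun E' hE' => ?_⟩⟩
  · let S := {p : ℕ | p.Prime ∧ p ≡ 3 [MOD 4]}
    have : Infinite S :=
      (Nat.infinite_setOfPred_prime_and_modEq (by norm_num) (by norm_num)).to_subtype
    have hS : ∀ p : S, NotNorm (-1 : K) ((p : ℕ) : ℚ) := fun p => by
      have := Fact.mk p.2.1
      exact hnorm _ (notNorm_neg_one_of_odd_padicValNat p.2.1 p.2.2 (by simp))
    let F : S → QuatStar K := fun p =>
      Quotient.mk _ ((hS p).quatDivAlg h2 (neg_ne_zero.2 one_ne_zero))
    refine Infinite.of_injective F fun p q hpq => ?_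
    by_contra hne
    obtain ⟨e⟩ : Nonempty (((hS p).quatDivAlg h2 (neg_ne_zero.2 one_ne_zero)) ≃ₐ[K]
      ((hS q).quatDivAlg h2 (neg_ne_zero.2 one_ne_zero))) := Quotient.exact hpq
    obtain ⟨r, s, hrs⟩ := QuaternionAlgebra.exists_norm_of_algEquiv (hS q) h2
      (neg_ne_zero.2 one_ne_zero) e
    -- The isomorphism makes `pq` a norm from `K(√-1)`, but `p` divides `pq` exactly once, so `(-1,
    -- pq)` is nonsplit.
    have hval : Odd (padicValNat p ((p : ℕ) * q)) := by
      have := Fact.mk p.2.1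
      have := Fact.mk q.2.1
      rw [padicValNat.mul p.2.1.ne_zero q.2.1.ne_zero, padicValNat_self,
        padicValNat_primes fun h => hne (Subtype.ext h)]
      exact odd_one
    refine hnorm _ (notNorm_neg_one_of_odd_padicValNat p.2.1 p.2.2 hval) r s ?_
    rw [hrs]
    push_cast
    rfl
  · exact D.isQuaternionAlgebra.exists_isMaximalSubfield_algEquiv D'.isQuaternionAlgebra h2 hrep hE
  · obtain ⟨E, hE, ⟨e⟩⟩ := D'.isQuaternionAlgebra.exists_isMaximalSubfield_algEquiv
      D.isQuaternionAlgebra h2 hrep hE'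
    exact ⟨E, hE, ⟨e.symm⟩⟩
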